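/- Theorem 3.2 (Oracle inequality). Let $p\ge 0$, $K\ge 1.87$ and $\alpha>0$. There is a constant $C_{est}\ge 1$, depending only on $K$, $\alpha$ and $p$, such that the following holds for every $\varepsilon>0$ and every $\theta_0\in\ell_2$. Put $\sigma_i^2=\varepsilon^2 i^{2p}$ and let $X=(X_i)_{i\in\mathbb N}\sim \mathrm P_{\theta_0}=\bigotimes_{i\in\mathbb N}N(\theta_{0,i},\sigma_i^2)$, where $\mathbb N=\{1,2,\dots\}$. For $i,I\in\mathbb N$ let $X_i(I)=X_i 1\{i\le I\}$, $X(I)=(X_i(I))_{i}$, $\tau_i^2(I)=K\sigma_i^2 1\{i\le I\}$, $\lambda_I=(e^\alpha-1)e^{-\alpha I}$, let $\varphi(\cdot,\mu,s^2)$ be the density of $N(\mu,s^2)$, and $$\mathrm P(\mathcal I=I|X)=\lim_{n\to\infty}\frac{\lambda_I\prod_{i=1}^n\varphi(X_i,X_i(I),\tau_i^2(I)+\sigma_i^2)}{\sum_{J\in\mathbb N}\lambda_J\prod_{i=1}^n\varphi(X_i,X_i(J),\tau_i^2(J)+\sigma_i^2)} .$$ These limits exist and satisfy $\sum_I\mathrm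 P(\mathcal I=I|X)=1$, $\mathrm P_{\theta_0}$-almost surely. Let $$\mathrm P(\cdot|X)=\sum_{I}\mathrm P(\mathcal I=I|X)\,\bigotimes_i N\Big(X_i(I),\tfrac{K}{K+1}\sigma_i^2 1\{i\le I\}\Big)$$ ($N(\mu,0)$ is the Dirac measure at $\mu$). Its mean exists coordinatewise and equals $$\tilde\theta=\mathrm E(\theta|X)=\sum_I X(I)\,\mathrm P(\mathcal I=I|X)\qquad \mathrm P_{\theta_0}\text{-almost surely};$$ the right-hand side defines a measurable function $\tilde\theta$ of $X$. Moreover $$\mathrm E_{\theta_0}\|\tilde\theta-\theta_0\|^2\le C_{est}\,r^2(\theta_0),\qquad r^2(\theta_0)=\min_{I\in\mathbb N}\Big(\sum_{i\le I}\sigma_i^2+\sum_{i>I}\theta_{0,i}^2\Big).$$ -/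

import Mathlib

open MeasureTheory ProbabilityTheory Filter Topology

/-!
Conventions. Sequences `(a_1, a_2, …)` are functions `ℕ → ℝ`: the entry with index `i : ℕ` is
`a_{i+1}`. Levels are shifted in the same way: `I : ℕ` stands for the level `I + 1 ∈ {1, 2, …}`.
So the condition "coordinate index at most the level" reads `i ≤ I`.
-/

noncomputable section

namespace DDM

/-- Noise variances of the mildly ill-posed model: `σ_i² = ε² i^{2p}`. -/
def noiseVar (p ε : ℝ) (i : ℕ) : ℝ := ε ^ 2 * ((i : ℝ) + 1) ^ (2 * p)

/-- The law `P_θ = ⨂_i N(θ_i, σ_i²)` of the observed sequence. -/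
def dataLaw (p ε : ℝ) (θ : ℕ → ℝ) : Measure (ℕ → ℝ) :=
  Measure.infinitePi fun i => gaussianReal (θ i) (noiseVar p ε i).toNNReal

/-- The truncated sequence `X(I) = (X_i 1{i ≤ I})_i`. -/
def trunc (X : ℕ → ℝ) (I i : ℕ) : ℝ := if i ≤ I then X i else 0

/-- The prior variances `τ_i²(I) = K σ_i² 1{i ≤ I}`. -/
def priorVar (p K ε : ℝ) (I i : ℕ) : ℝ := if i ≤ I then K * noiseVar p ε i else 0

/-- The prior weights `λ_I = (e^α - 1) e^{-α I}`. -/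
def levelWeight (α : ℝ) (I : ℕ) : ℝ := (Real.exp α - 1) * Real.exp (-α * ((I : ℝ) + 1))

/-- The marginal likelihood of level `I` based on the first `n` coordinates, that is
`∏_{i=1}^n φ(X_i, X_i(I), τ_i²(I) + σ_i²)`. -/
def levelLik (p K ε : ℝ) (n : ℕ) (X : ℕ → ℝ) (I : ℕ) : ℝ :=
  ∏ i ∈ Finset.range n,
    gaussianPDFReal (trunc X I i) (priorVar p K ε I i + noiseVar p ε i).toNNReal (X i)

/-- `P_n(I | X)`: the weight of level `I` based on the first `n` coordinates. -/
def levelPostN (p K α ε : ℝ) (n : ℕ) (X : ℕ → ℝ) (I : ℕ) : ℝ :=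
  levelWeight α I * levelLik p K ε n X I / ∑' J, levelWeight α J * levelLik p K ε n X J

/-- `P(I | X) = lim_n P_n(I | X)`. -/
def levelPost (p K α ε : ℝ) (X : ℕ → ℝ) (I : ℕ) : ℝ :=
  limUnder atTop fun n => levelPostN p K α ε n X I

/-- `P_I(· | X) = ⨂_i N(X_i(I), L σ_i² 1{i ≤ I})` with `L = K / (K + 1)`; a normal law with
variance zero is a Dirac measure. -/
def levelDDM (p K ε : ℝ) (X : ℕ → ℝ) (I : ℕ) : Measure (ℕ → ℝ) :=
  Measure.infinitePi fun i =>
    gaussianReal (trunc X I i) (if i ≤ I then K / (K + 1) * noiseVar p ε i else 0).toNNReal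

/-- The data dependent measure `P(· | X) = ∑_I P(I | X) P_I(· | X)`. -/
def ddm (p K α ε : ℝ) (X : ℕ → ℝ) : Measure (ℕ → ℝ) :=
  Measure.sum fun I => ENNReal.ofReal (levelPost p K α ε X I) • levelDDM p K ε X I

/-- The estimator `∑_I X(I) P(I | X)`, coordinate by coordinate. -/
def postMean (p K α ε : ℝ) (X : ℕ → ℝ) (i : ℕ) : ℝ :=
  ∑' I, trunc X I i * levelPost p K α ε X I

/-- The local rate `r²(I, θ) = ∑_{i ≤ I} σ_i² + ∑_{i > I} θ_i²`. -/
def rateSq (p ε : ℝ) (θ : ℕ → ℝ) (I : ℕ) : ℝ :=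
  ∑ i ∈ Finset.range (I + 1), noiseVar p ε i + ∑' i, θ (i + (I + 1)) ^ 2

/-- The oracle rate `r²(θ) = min_I r²(I, θ)`. -/
def oracleRateSq (p ε : ℝ) (θ : ℕ → ℝ) : ℝ := ⨅ I, rateSq p ε θ I

/-- The risk `E_θ ‖T(X) - θ‖²` of an estimator `T`, as an extended nonnegative number. -/
def risk (p ε : ℝ) (T : (ℕ → ℝ) → ℕ → ℝ) (θ : ℕ → ℝ) : ENNReal :=
  ∫⁻ X, ∑' i, ENNReal.ofReal ((T X i - θ i) ^ 2) ∂(dataLaw p ε θ)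

end DDM

end

/-! ### Level weights as normalized likelihood ratios -/

namespace DDM

/-! Dividing each likelihood by that of the zero signal turns the weight of a level into
`levelMass`: the prior weight times one factor `(K + 1)^(-1/2) exp (X_i² / (2 σ_i²))` per fitted
coordinate. Ratios of masses are therefore products of independent factors. Two moments of a factor
suffice. Its power `1/10` has mean at most `exp (θ_i² / (18 σ_i²))`, which is where `K ≥ 1.87`
enters, and its inverse has mean at most `exp (K - θ_i² / (4 σ_i²))`. The first moment also makes
the masses almost surely summable, and hence the limits exist.

The estimator is the shrinkage `q_i X_i`, where `q_i` is the posterior probability of fitting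
coordinate `i` (`postMean_eq_fitProb_mul`). By convexity its squared error is at most `q_i (X_i -
θ_i)² + (1 - q_i) θ_i²`, and the two sums are controlled with two different reference levels.

The level `I₀` minimizes `(9/10) α ∑_{i ≤ I} σ_i²` plus squared bias. Beyond it the signal-to-noise
ratios add up to less than the prior decay can absorb, so `q_i` has exponentially small mean there
and the noise term is of order `∑_{i ≤ I₀} σ_i²` (`tsum_lintegral_fitProb_mul_sq_le`). The level
`I₁` minimizes a large multiple of `I σ_I²` (levels counted from 1) plus squared bias. Stopping
before it misses so much signal that those levels get exponentially small weight, and the bias term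
is of order `σ_{I₁}²` plus the squared bias at `I₁` (`tsum_lintegral_one_sub_fitProb_mul_sq_le`).
Since `I σ_I² ≤ (2p + 1) ∑_{i ≤ I} σ_i²`, both minima are at most a constant times the oracle rate.
-/

lemma noiseVar_pos {p ε : ℝ} (hε : 0 < ε) (i : ℕ) : 0 < noiseVar p ε i := by
  unfold noiseVar; positivity

lemma noiseVar_mono {p ε : ℝ} (hp : 0 ≤ p) : Monotone (noiseVar p ε) := by
  intro i j hij
  unfold noiseVar
  gcongr

/-- The likelihood ratio, based on the first `k` coordinates, between fitting all of them and
fitting none of them. -/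
noncomputable def gain (p K ε : ℝ) (X : ℕ → ℝ) (k : ℕ) : ℝ :=
  ∏ i ∈ Finset.range k, ((√(K + 1))⁻¹ * Real.exp (X i ^ 2 / (2 * noiseVar p ε i)))

/-- The unnormalized posterior weight of a level. -/
noncomputable def levelMass (p K α ε : ℝ) (X : ℕ → ℝ) (I : ℕ) : ℝ :=
  levelWeight α I * gain p K ε X (I + 1)

/-- The normalized posterior weight of a level. -/
noncomputable def levelProb (p K α ε : ℝ) (X : ℕ → ℝ) (I : ℕ) : ℝ :=
  levelMass p K α ε X I / ∑' J, levelMass p K α ε X J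

variable {p K α ε : ℝ} {X : ℕ → ℝ}

lemma gain_pos (hK : 0 < K) (k : ℕ) : 0 < gain p K ε X k := by
  unfold gain
  exact Finset.prod_pos fun i _ => by positivity

lemma levelWeight_pos (hα : 0 < α) (I : ℕ) : 0 < levelWeight α I := by
  have : 1 < Real.exp α := Real.one_lt_exp_iff.2 hα
  exact mul_pos (by linarith) (Real.exp_pos _)

lemma levelWeight_add (m k : ℕ) :
    levelWeight α (m + k) = levelWeight α m * Real.exp (-α * k) := by
  unfold levelWeight
  rw [mul_assoc, ← Real.exp_add]
  push_cast
  ring_nf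

lemma levelMass_pos (hK : 0 < K) (hα : 0 < α) (I : ℕ) : 0 < levelMass p K α ε X I :=
  mul_pos (levelWeight_pos hα I) (gain_pos hK _)

/-- A fitted coordinate has its density evaluated at its own mean, with variance `(K + 1) σ_i²`, so
only the normalization remains; an unfitted one contributes the null density. The null likelihood
does not depend on the level and cancels in the posterior. -/
lemma levelLik_eq (hε : 0 < ε) (hK : 0 < K) (n I : ℕ) :
    levelLik p K ε n X I =
      (∏ i ∈ Finset.range n, gaussianPDFReal 0 (noiseVar p ε i).toNNReal (X i)) *
        gain p K ε X (min (I + 1) n) := by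
  have h : Finset.range (min (I + 1) n) = (Finset.range n).filter (fun i => i ≤ I) := by
    ext i; simp; omega
  rw [gain, h, Finset.prod_filter, ← Finset.prod_mul_distrib, levelLik]
  refine Finset.prod_congr rfl fun i _ => ?_
  have hv := noiseVar_pos (p := p) hε i
  have hv' : 0 ≤ K * noiseVar p ε i + noiseVar p ε i := by positivity
  by_cases hi : i ≤ I
  · simp only [gaussianPDFReal, trunc, priorVar, hi, if_true, sub_self, Real.coe_toNNReal _ hv',
      Real.coe_toNNReal _ hv.le]
    have e : 2 * Real.pi * (K * noiseVar p ε i + noiseVar p ε i)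
        = (K + 1) * (2 * Real.pi * noiseVar p ε i) := by ring
    rw [e, Real.sqrt_mul (by positivity)]
    have e2 : -(X i - 0) ^ 2 / (2 * noiseVar p ε i) = -(X i ^ 2 / (2 * noiseVar p ε i)) := by ring
    rw [e2, Real.exp_neg]
    have := Real.exp_pos (X i ^ 2 / (2 * noiseVar p ε i))
    simp
    field_simp
  · simp [gaussianPDFReal, trunc, priorVar, hi]

lemma levelPostN_eq (hε : 0 < ε) (hK : 0 < K) (n I : ℕ) :
    levelPostN p K α ε n X I = levelWeight α I * gain p K ε X (min (I + 1) n) /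
      ∑' J, levelWeight α J * gain p K ε X (min (J + 1) n) := by
  unfold levelPostN
  simp_rw [levelLik_eq hε hK, mul_left_comm (levelWeight α _), tsum_mul_left]
  refine mul_div_mul_left _ _ (ne_of_gt ?_)
  exact Finset.prod_pos fun i _ => gaussianPDFReal_pos _ _ _ (by simpa using noiseVar_pos hε i)

lemma summable_exp_neg_mul {c : ℝ} (hc : 0 < c) : Summable fun k : ℕ => Real.exp (-c * k) := by
  simpa using Real.summable_pow_mul_exp_neg_nat_mul 0 hc

lemma tendsto_levelPostN (hε : 0 < ε) (hK : 0 < K) (hα : 0 < α)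
    (hs : Summable (levelMass p K α ε X)) (I : ℕ) :
    Tendsto (fun n => levelPostN p K α ε n X I) atTop (𝓝 (levelProb p K α ε X I)) := by
  simp_rw [levelPostN_eq hε hK]
  refine Tendsto.div ?_ ?_ (hs.tsum_pos (fun J => (levelMass_pos hK hα J).le) 0
    (levelMass_pos hK hα 0)).ne'
  · refine tendsto_const_nhds.congr' ?_
    filter_upwards [eventually_ge_atTop (I + 1)] with n hn
    rw [min_eq_left hn, levelMass]
  -- With `m + 1` observed coordinates the gain is frozen beyond level `m`, so the levels `m + k`
  -- form a geometric series proportional to the mass of level `m`, which tends to zero.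
  · rw [← tendsto_add_atTop_iff_nat 1]
    have hE : Summable fun k : ℕ => Real.exp (-α * ((k + 1 : ℕ) : ℝ)) :=
      (summable_nat_add_iff (f := fun k : ℕ => Real.exp (-α * k)) 1).2 (summable_exp_neg_mul hα)
    have key : ∀ m : ℕ, ∑' J, levelWeight α J * gain p K ε X (min (J + 1) (m + 1)) =
        ∑ J ∈ Finset.range (m + 1), levelMass p K α ε X J +
          levelMass p K α ε X m * ∑' k : ℕ, Real.exp (-α * ((k + 1 : ℕ) : ℝ)) := by
      intro m
      have e : ∀ k, levelWeight α (k + (m + 1)) * gain p K ε X (min (k + (m + 1) + 1) (m + 1)) =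
          levelMass p K α ε X m * Real.exp (-α * ((k + 1 : ℕ) : ℝ)) := by
        intro k
        rw [min_eq_right (by omega), show k + (m + 1) = m + (k + 1) by ring, levelWeight_add,
          levelMass]
        ring
      have hs' : Summable fun J => levelWeight α J * gain p K ε X (min (J + 1) (m + 1)) := by
        rw [← summable_nat_add_iff (m + 1)]
        simp_rw [e]
        exact hE.mul_left _
      rw [← hs'.sum_add_tsum_nat_add (m + 1)]
      simp_rw [e, tsum_mul_left]
      congr 1
      refine Finset.sum_congr rfl fun J hJ => ?_
      rw [min_eq_left (by simp at hJ; omega), levelMass]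
    simp_rw [key]
    have h1 : Tendsto (fun m => ∑ J ∈ Finset.range (m + 1), levelMass p K α ε X J) atTop
        (𝓝 (∑' J, levelMass p K α ε X J)) :=
      (tendsto_add_atTop_iff_nat 1).2 hs.hasSum.tendsto_sum_nat
    simpa using h1.add (hs.tendsto_atTop_zero.mul_const
      (∑' k : ℕ, Real.exp (-α * ((k + 1 : ℕ) : ℝ))))

lemma levelPost_eq (hε : 0 < ε) (hK : 0 < K) (hα : 0 < α)
    (hs : Summable (levelMass p K α ε X)) : levelPost p K α ε X = levelProb p K α ε X :=
  funext fun I => (tendsto_levelPostN hε hK hα hs I).limUnder_eq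

lemma hasSum_levelProb (hK : 0 < K) (hα : 0 < α) (hs : Summable (levelMass p K α ε X)) :
    HasSum (levelProb p K α ε X) 1 := by
  have hZ := (hs.tsum_pos (fun J => (levelMass_pos hK hα J).le) 0 (levelMass_pos hK hα 0)).ne'
  have h := hs.hasSum.div_const (∑' J, levelMass p K α ε X J)
  rwa [div_self hZ] at h

lemma levelProb_nonneg (hK : 0 < K) (hα : 0 < α) (I : ℕ) : 0 ≤ levelProb p K α ε X I :=
  div_nonneg (levelMass_pos hK hα I).le (tsum_nonneg fun J => (levelMass_pos hK hα J).le)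

lemma levelProb_le_ratio (hK : 0 < K) (hα : 0 < α) (I J : ℕ) :
    levelProb p K α ε X I ≤ levelMass p K α ε X I / levelMass p K α ε X J := by
  by_cases hs : Summable (levelMass p K α ε X)
  · exact div_le_div_of_nonneg_left (levelMass_pos hK hα I).le (levelMass_pos hK hα J)
      (hs.le_tsum J fun i _ => (levelMass_pos hK hα i).le)
  -- Without summability the normalizing `tsum` is 0 and so is the quotient; the bound thus holds
  -- for every `X`.
  · rw [levelProb, tsum_eq_zero_of_not_summable hs, div_zero]
    exact (div_pos (levelMass_pos hK hα I) (levelMass_pos hK hα J)).le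

lemma levelProb_le_one (hK : 0 < K) (hα : 0 < α) (I : ℕ) : levelProb p K α ε X I ≤ 1 :=
  (levelProb_le_ratio hK hα I I).trans_eq (div_self (levelMass_pos hK hα I).ne')

lemma levelMass_div {I J : ℕ} (hIJ : I ≤ J) (hK : 0 < K) (hα : 0 < α) :
    levelMass p K α ε X J / levelMass p K α ε X I =
      Real.exp (-α * ((J - I : ℕ) : ℝ)) * ∏ i ∈ Finset.Ico (I + 1) (J + 1),
        ((√(K + 1))⁻¹ * Real.exp (X i ^ 2 / (2 * noiseVar p ε i))) := by
  rw [div_eq_iff (levelMass_pos hK hα I).ne', levelMass, levelMass]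
  nth_rewrite 1 [← Nat.add_sub_cancel' hIJ]
  rw [levelWeight_add, gain, gain, ← Finset.prod_range_mul_prod_Ico _ (by omega : I + 1 ≤ J + 1)]
  ring

lemma measurable_trunc (I i : ℕ) : Measurable fun X => trunc X I i := by
  unfold trunc
  split_ifs <;> fun_prop

lemma measurable_gain (k : ℕ) : Measurable fun X => gain p K ε X k := by
  unfold gain
  fun_prop

lemma measurable_levelMass (I : ℕ) : Measurable fun X => levelMass p K α ε X I :=
  (measurable_gain _).const_mul _

lemma measurable_levelProb (I : ℕ) : Measurable fun X => levelProb p K α ε X I :=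
  (measurable_levelMass I).div (Measurable.tsum fun J => measurable_levelMass J)

lemma measurable_levelLik (n I : ℕ) : Measurable fun X => levelLik p K ε n X I := by
  unfold levelLik
  refine Finset.measurable_prod _ fun i _ => ?_
  exact measurable_uncurry_gaussianPDFReal.comp
    ((measurable_trunc I i).prodMk (measurable_const.prodMk (measurable_pi_apply i)))

/-- The limit need exist only almost surely; `limUnder` takes a fixed default value elsewhere, which
preserves measurability. -/
lemma measurable_levelPost (I : ℕ) : Measurable fun X => levelPost p K α ε X I := by
  unfold levelPost
  refine (StronglyMeasurable.limUnder fun n => Measurable.stronglyMeasurable ?_).measurable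
  exact ((measurable_levelLik n I).const_mul _).div
    (Measurable.tsum fun J => (measurable_levelLik n J).const_mul _)

lemma measurable_postMean : Measurable (postMean p K α ε) := by
  refine measurable_pi_lambda _ fun i => ?_
  exact Measurable.tsum fun I => (measurable_trunc I i).mul (measurable_levelPost I)

end DDM

/-! ### Gaussian moments -/

/-- Completing the square: the tilted density is a multiple of the density of `N(μ / (1 - t), v / (1
- t))`. -/
lemma lintegral_exp_sq_gaussianReal {t v : ℝ} (μ : ℝ) (ht : t < 1) (hv : 0 < v) :
    ∫⁻ x, ENNReal.ofReal (Real.exp (t * (x ^ 2 / (2 * v)))) ∂(gaussianReal μ v.toNNReal) =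
      ENNReal.ofReal ((√(1 - t))⁻¹ * Real.exp (t / (1 - t) * (μ ^ 2 / (2 * v)))) := by
  have ht' : 0 < 1 - t := by linarith
  have hv0 : v.toNNReal ≠ 0 := by simpa using hv
  have hw0 : (v / (1 - t)).toNNReal ≠ 0 := by simpa using div_pos hv ht'
  rw [gaussianReal_of_var_ne_zero _ hv0,
    lintegral_withDensity_eq_lintegral_mul _ (measurable_gaussianPDF _ _) (by fun_prop)]
  have h : ∀ x, (gaussianPDF μ v.toNNReal * fun x => ENNReal.ofReal
      (Real.exp (t * (x ^ 2 / (2 * v))))) x =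
      ENNReal.ofReal ((√(1 - t))⁻¹ * Real.exp (t / (1 - t) * (μ ^ 2 / (2 * v)))) *
        gaussianPDF (μ / (1 - t)) (v / (1 - t)).toNNReal x := by
    intro x
    rw [Pi.mul_apply, gaussianPDF, gaussianPDF, ← ENNReal.ofReal_mul (gaussianPDFReal_nonneg _ _ _),
      ← ENNReal.ofReal_mul (by positivity)]
    congr 1
    rw [gaussianPDFReal, gaussianPDFReal, Real.coe_toNNReal _ hv.le,
      Real.coe_toNNReal _ (div_pos hv ht').le, mul_assoc, ← Real.exp_add, mul_mul_mul_comm,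
      ← Real.exp_add, ← mul_inv, ← Real.sqrt_mul ht'.le]
    congr 1
    · congr 2
      field_simp
    · congr 1
      field_simp
      ring
  simp_rw [h]
  rw [lintegral_const_mul _ (measurable_gaussianPDF _ _), lintegral_gaussianPDF_eq_one _ hw0,
    mul_one]

/-- The centred exponential moment at `t = 1/2` is `√2 ≤ 2`. Polynomial moments follow by bounding
powers by the exponential, with crude constants. -/
lemma lintegral_ofReal_le_of_le_exp_sq {v c : ℝ} {f : ℝ → ℝ} (μ : ℝ) (hv : 0 < v) (hc : 0 ≤ c)
    (hf : ∀ x, f x ≤ c * Real.exp (1 / 2 * ((x - μ) ^ 2 / (2 * v)))) :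
    ∫⁻ x, ENNReal.ofReal (f x) ∂(gaussianReal μ v.toNNReal) ≤ ENNReal.ofReal (2 * c) := by
  calc ∫⁻ x, ENNReal.ofReal (f x) ∂(gaussianReal μ v.toNNReal)
      ≤ ∫⁻ x, ENNReal.ofReal c * ENNReal.ofReal (Real.exp (1 / 2 * ((x - μ) ^ 2 / (2 * v))))
          ∂(gaussianReal μ v.toNNReal) := by
        refine lintegral_mono fun x => ?_
        rw [← ENNReal.ofReal_mul hc]
        exact ENNReal.ofReal_le_ofReal (hf x)
    _ = ENNReal.ofReal c * ∫⁻ y, ENNReal.ofReal (Real.exp (1 / 2 * (y ^ 2 / (2 * v))))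
          ∂((gaussianReal μ v.toNNReal).map (· - μ)) := by
        rw [lintegral_const_mul _ (by fun_prop), lintegral_map (by fun_prop) (by fun_prop)]
    _ ≤ ENNReal.ofReal (2 * c) := by
        rw [gaussianReal_map_sub_const, sub_self, lintegral_exp_sq_gaussianReal _ (by norm_num) hv,
          ← ENNReal.ofReal_mul hc]
        refine ENNReal.ofReal_le_ofReal ?_
        have h : (√(1 - 1 / 2 : ℝ))⁻¹ ≤ 2 := by
          rw [inv_le_comm₀ (by norm_num [Real.sqrt_pos]) (by norm_num)]
          exact Real.le_sqrt_of_sq_le (by norm_num)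
        simp only [ne_eq, OfNat.ofNat_ne_zero, not_false_eq_true, zero_pow, zero_div, mul_zero,
          Real.exp_zero, mul_one]
        nlinarith

lemma lintegral_sq_sub_gaussianReal_le {v : ℝ} (μ : ℝ) (hv : 0 < v) :
    ∫⁻ x, ENNReal.ofReal ((x - μ) ^ 2) ∂(gaussianReal μ v.toNNReal) ≤ ENNReal.ofReal (8 * v) := by
  rw [show 8 * v = 2 * (4 * v) by ring]
  refine lintegral_ofReal_le_of_le_exp_sq μ hv (by positivity) fun x => ?_
  have h := Real.add_one_le_exp (1 / 2 * ((x - μ) ^ 2 / (2 * v)))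
  calc (x - μ) ^ 2 = 4 * v * (1 / 2 * ((x - μ) ^ 2 / (2 * v))) := by field_simp; ring
    _ ≤ _ := by gcongr; linarith

lemma lintegral_pow_four_sub_gaussianReal_le {v : ℝ} (μ : ℝ) (hv : 0 < v) :
    ∫⁻ x, ENNReal.ofReal ((x - μ) ^ 4 / v) ∂(gaussianReal μ v.toNNReal) ≤
      ENNReal.ofReal (64 * v) := by
  rw [show 64 * v = 2 * (32 * v) by ring]
  refine lintegral_ofReal_le_of_le_exp_sq μ hv (by positivity) fun x => ?_
  have h := Real.quadratic_le_exp_of_nonneg (x := 1 / 2 * ((x - μ) ^ 2 / (2 * v))) (by positivity)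
  have h0 : 0 ≤ 1 / 2 * ((x - μ) ^ 2 / (2 * v)) := by positivity
  calc (x - μ) ^ 4 / v = 32 * v * ((1 / 2 * ((x - μ) ^ 2 / (2 * v))) ^ 2 / 2) := by
        field_simp; ring
    _ ≤ _ := by gcongr; linarith

/-! ### Moments of likelihood ratios under the data law -/

namespace DDM

variable {p K α ε : ℝ}

instance isProbabilityMeasure_dataLaw (θ : ℕ → ℝ) : IsProbabilityMeasure (dataLaw p ε θ) := by
  unfold dataLaw; infer_instance

lemma lintegral_prod_dataLaw (θ : ℕ → ℝ) (s : Finset ℕ) {f : ℕ → ℝ → ENNReal}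
    (hf : ∀ i, Measurable (f i)) :
    ∫⁻ X, ∏ i ∈ s, f i (X i) ∂(dataLaw p ε θ) =
      ∏ i ∈ s, ∫⁻ x, f i x ∂(gaussianReal (θ i) (noiseVar p ε i).toNNReal) := by
  refine (lintegral_prod_eq_prod_lintegral_of_indepFun s
    (fun i (X : ℕ → ℝ) => f i (X i))
    (iIndepFun_infinitePi hf) fun i => (hf i).comp (measurable_pi_apply i)).trans ?_
  refine Finset.prod_congr rfl fun i _ => ?_
  exact (measurePreserving_eval_infinitePi _ i).lintegral_comp (hf i)

lemma lintegral_eval_dataLaw (θ : ℕ → ℝ) (i : ℕ) {f : ℝ → ENNReal} (hf : Measurable f) :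
    ∫⁻ X, f (X i) ∂(dataLaw p ε θ) =
      ∫⁻ x, f x ∂(gaussianReal (θ i) (noiseVar p ε i).toNNReal) :=
  (measurePreserving_eval_infinitePi _ i).lintegral_comp hf

/-- The 20th power clears all roots and reduces the claim to `(K + 1) (9/10)^10 ≥ 1`, that is, to
`K` at least about `1.868`. -/
lemma rpow_inv_sqrt_mul_le_one (hK : 1.87 ≤ K) :
    ((√(K + 1))⁻¹ ^ (1 / 10 : ℝ)) * (√(1 - 1 / 10 : ℝ))⁻¹ ≤ 1 := by
  have hK1 : 0 < √(K + 1) := Real.sqrt_pos.2 (by linarith)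
  have h9 : (0:ℝ) < √(1 - 1 / 10) := Real.sqrt_pos.2 (by norm_num)
  rw [Real.inv_rpow hK1.le, ← mul_inv]
  refine inv_le_one_of_one_le₀ ?_
  have hnn : 0 ≤ √(K + 1) ^ (1 / 10 : ℝ) * √(1 - 1 / 10 : ℝ) := by positivity
  refine (one_le_pow_iff_of_nonneg hnn (n := 20) (by norm_num)).1 ?_
  have e1 : (√(K + 1) ^ (1 / 10 : ℝ)) ^ 20 = K + 1 := by
    rw [← Real.rpow_natCast, ← Real.rpow_mul hK1.le]
    norm_num
    exact Real.sq_sqrt (by linarith)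
  have e2 : (√(1 - 1 / 10 : ℝ)) ^ 20 = (9 / 10) ^ 10 := by
    rw [show 20 = 2 * 10 by norm_num, pow_mul, Real.sq_sqrt (by norm_num)]
    norm_num
  rw [mul_pow, e1, e2]
  norm_num at hK ⊢
  linarith

lemma lintegral_rpow_factor_le (hK : 1.87 ≤ K) {v : ℝ} (μ : ℝ) (hv : 0 < v) :
    ∫⁻ x, ENNReal.ofReal (((√(K + 1))⁻¹ * Real.exp (x ^ 2 / (2 * v))) ^ (1 / 10 : ℝ))
      ∂(gaussianReal μ v.toNNReal) ≤ ENNReal.ofReal (Real.exp (μ ^ 2 / v / 18)) := by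
  have h : ∀ x : ℝ, ((√(K + 1))⁻¹ * Real.exp (x ^ 2 / (2 * v))) ^ (1 / 10 : ℝ) =
      (√(K + 1))⁻¹ ^ (1 / 10 : ℝ) * Real.exp (1 / 10 * (x ^ 2 / (2 * v))) := by
    intro x
    rw [Real.mul_rpow (by positivity) (by positivity), ← Real.exp_mul, mul_comm (1 / 10 : ℝ)]
  simp_rw [h, ENNReal.ofReal_mul (show 0 ≤ (√(K + 1))⁻¹ ^ (1 / 10 : ℝ) by positivity)]
  rw [lintegral_const_mul _ (by fun_prop), lintegral_exp_sq_gaussianReal _ (by norm_num) hv,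
    ← ENNReal.ofReal_mul (by positivity)]
  refine ENNReal.ofReal_le_ofReal ?_
  rw [← mul_assoc]
  refine (mul_le_of_le_one_left (by positivity) (rpow_inv_sqrt_mul_le_one hK)).trans_eq ?_
  congr 1
  field_simp
  ring

lemma lintegral_inv_factor_le (hK : 0 < K) {v : ℝ} (μ : ℝ) (hv : 0 < v) :
    ∫⁻ x, ENNReal.ofReal (((√(K + 1))⁻¹ * Real.exp (x ^ 2 / (2 * v)))⁻¹)
      ∂(gaussianReal μ v.toNNReal) ≤ ENNReal.ofReal (Real.exp (K - μ ^ 2 / v / 4)) := by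
  have h : ∀ x : ℝ, ((√(K + 1))⁻¹ * Real.exp (x ^ 2 / (2 * v)))⁻¹ =
      √(K + 1) * Real.exp (-1 * (x ^ 2 / (2 * v))) := by
    intro x
    rw [mul_inv, inv_inv, ← Real.exp_neg, neg_one_mul]
  simp_rw [h, ENNReal.ofReal_mul (Real.sqrt_nonneg (K + 1))]
  rw [lintegral_const_mul _ (by fun_prop), lintegral_exp_sq_gaussianReal _ (by norm_num) hv,
    ← ENNReal.ofReal_mul (by positivity)]
  refine ENNReal.ofReal_le_ofReal ?_
  rw [sub_eq_add_neg K, Real.exp_add]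
  refine mul_le_mul ?_ ?_ (by positivity) (by positivity)
  -- `√(K + 1) ≤ K + 1 ≤ exp K`.
  · refine le_trans ?_ (Real.add_one_le_exp K)
    rw [Real.sqrt_le_left (by linarith)]
    nlinarith
  · refine (mul_le_of_le_one_left (by positivity) ?_).trans_eq ?_
    · refine inv_le_one_of_one_le₀ (Real.one_le_sqrt.2 (by norm_num))
    · congr 1
      field_simp
      ring

lemma lintegral_rpow_levelMass_div_le (hε : 0 < ε) (hK : 1.87 ≤ K) (hα : 0 < α) (θ : ℕ → ℝ)
    {I J : ℕ} (hIJ : I ≤ J) :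
    ∫⁻ X, ENNReal.ofReal ((levelMass p K α ε X J / levelMass p K α ε X I) ^ (1 / 10 : ℝ))
        ∂(dataLaw p ε θ) ≤
      ENNReal.ofReal (Real.exp (-α * ((J - I : ℕ) : ℝ) / 10 +
        (∑ i ∈ Finset.Ico (I + 1) (J + 1), θ i ^ 2 / noiseVar p ε i) / 18)) := by
  have hK0 : 0 < K := by linarith
  have h : ∀ X : ℕ → ℝ,
      ENNReal.ofReal ((levelMass p K α ε X J / levelMass p K α ε X I) ^ (1 / 10 : ℝ)) =
      ENNReal.ofReal (Real.exp (-α * ((J - I : ℕ) : ℝ) / 10)) *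
      ∏ i ∈ Finset.Ico (I + 1) (J + 1), ENNReal.ofReal
        (((√(K + 1))⁻¹ * Real.exp (X i ^ 2 / (2 * noiseVar p ε i))) ^ (1 / 10 : ℝ)) := by
    intro X
    rw [levelMass_div hIJ hK0 hα, Real.mul_rpow (by positivity)
      (Finset.prod_nonneg fun i _ => by positivity), ← Real.exp_mul,
      ← Real.finsetProd_rpow _ _ (fun i _ => by positivity),
      ENNReal.ofReal_mul (by positivity), ENNReal.ofReal_prod_of_nonneg (fun i _ => by positivity)]
    ring_nf
  simp_rw [h]
  rw [lintegral_const_mul _ (Finset.measurable_prod _ fun i _ => by fun_prop),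
    lintegral_prod_dataLaw θ _ (f := fun i x => ENNReal.ofReal
        (((√(K + 1))⁻¹ * Real.exp (x ^ 2 / (2 * noiseVar p ε i))) ^ (1 / 10 : ℝ)))
        (fun i => by fun_prop),
    Real.exp_add, ENNReal.ofReal_mul (by positivity), Finset.sum_div, Real.exp_sum,
    ENNReal.ofReal_prod_of_nonneg (fun i _ => by positivity)]
  gcongr with i
  exact lintegral_rpow_factor_le hK (θ i) (noiseVar_pos hε i)

lemma lintegral_levelMass_div_le (hε : 0 < ε) (hK : 0 < K) (hα : 0 < α) (θ : ℕ → ℝ)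
    {I J : ℕ} (hIJ : I ≤ J) :
    ∫⁻ X, ENNReal.ofReal (levelMass p K α ε X I / levelMass p K α ε X J) ∂(dataLaw p ε θ) ≤
      ENNReal.ofReal (Real.exp ((α + K) * ((J - I : ℕ) : ℝ) -
        (∑ i ∈ Finset.Ico (I + 1) (J + 1), θ i ^ 2 / noiseVar p ε i) / 4)) := by
  have h : ∀ X : ℕ → ℝ,
      ENNReal.ofReal (levelMass p K α ε X I / levelMass p K α ε X J) =
      ENNReal.ofReal (Real.exp (α * ((J - I : ℕ) : ℝ))) *
      ∏ i ∈ Finset.Ico (I + 1) (J + 1), ENNReal.ofReal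
        (((√(K + 1))⁻¹ * Real.exp (X i ^ 2 / (2 * noiseVar p ε i)))⁻¹) := by
    intro X
    rw [← inv_div, levelMass_div hIJ hK hα, mul_inv, ← Real.exp_neg, ← Finset.prod_inv_distrib,
      ENNReal.ofReal_mul (by positivity), ENNReal.ofReal_prod_of_nonneg (fun i _ => by positivity),
      neg_mul, neg_neg]
  simp_rw [h]
  rw [lintegral_const_mul _ (Finset.measurable_prod _ fun i _ => by fun_prop),
    lintegral_prod_dataLaw θ _ (f := fun i x => ENNReal.ofReal
        (((√(K + 1))⁻¹ * Real.exp (x ^ 2 / (2 * noiseVar p ε i)))⁻¹))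
        (fun i => by fun_prop)]
  have e : (α + K) * ((J - I : ℕ) : ℝ) -
      (∑ i ∈ Finset.Ico (I + 1) (J + 1), θ i ^ 2 / noiseVar p ε i) / 4 = α * ((J - I : ℕ) : ℝ) +
      ∑ i ∈ Finset.Ico (I + 1) (J + 1), (K - θ i ^ 2 / noiseVar p ε i / 4) := by
    rw [Finset.sum_sub_distrib, Finset.sum_const, Finset.sum_div, Nat.card_Ico, nsmul_eq_mul,
      Nat.add_sub_add_right]
    ring
  rw [e, Real.exp_add, ENNReal.ofReal_mul (by positivity), Real.exp_sum,
    ENNReal.ofReal_prod_of_nonneg (fun i _ => by positivity)]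
  gcongr with i
  exact lintegral_inv_factor_le hK (θ i) (noiseVar_pos hε i)

end DDM

/-! ### Almost sure summability and the mean of the mixture -/

namespace DDM

variable {p K α ε : ℝ}

lemma summable_of_summable_rpow {f : ℕ → ℝ} (hf : ∀ i, 0 ≤ f i) {s : ℝ} (hs0 : 0 < s)
    (hs1 : s ≤ 1) (h : Summable fun i => f i ^ s) : Summable f := by
  refine h.of_norm_bounded_eventually_nat ?_
  filter_upwards [h.tendsto_atTop_zero.eventually (eventually_le_nhds zero_lt_one)] with i hi
  rw [Real.norm_of_nonneg (hf i)]
  have h1 : f i ≤ 1 := by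
    by_contra hc
    exact absurd hi (not_le.2 (Real.one_lt_rpow (not_le.1 hc) hs0))
  rcases (hf i).eq_or_lt with h0 | h0
  · rw [← h0, Real.zero_rpow hs0.ne']
  · simpa using Real.rpow_le_rpow_of_exponent_ge h0 h1 hs1

/-- The masses themselves have infinite mean, so the power `1/10` is summed instead: its means decay
geometrically because the total signal-to-noise ratio of a square summable `θ` is finite. Summable
powers with exponent at most 1 give summable masses. -/
lemma ae_summable_levelMass (hε : 0 < ε) (hp : 0 ≤ p) (hK : 1.87 ≤ K) (hα : 0 < α) {θ : ℕ → ℝ}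
    (hθ : Summable fun i => θ i ^ 2) :
    ∀ᵐ X ∂(dataLaw p ε θ), Summable (levelMass p K α ε X) := by
  have hK0 : 0 < K := by linarith
  set B : ℝ := ∑' i, θ i ^ 2 / noiseVar p ε 0
  have hsB : Summable fun i => θ i ^ 2 / noiseVar p ε 0 := hθ.div_const _
  have hle : ∀ J : ℕ, ∑ i ∈ Finset.Ico (0 + 1) (J + 1), θ i ^ 2 / noiseVar p ε i ≤ B := by
    intro J
    refine le_trans (Finset.sum_le_sum fun i _ => ?_) (hsB.sum_le_tsum _ fun i _ => ?_)
    · exact div_le_div_of_nonneg_left (sq_nonneg _) (noiseVar_pos hε 0)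
        (noiseVar_mono hp (Nat.zero_le i))
    · exact div_nonneg (sq_nonneg _) (noiseVar_pos hε 0).le
  have hm : ∀ J, Measurable fun X => ENNReal.ofReal
      ((levelMass p K α ε X J / levelMass p K α ε X 0) ^ (1 / 10 : ℝ)) := fun J =>
    (((measurable_levelMass J).div (measurable_levelMass 0)).pow_const _).ennreal_ofReal
  have hfin : ∫⁻ X, ∑' J, ENNReal.ofReal
      ((levelMass p K α ε X J / levelMass p K α ε X 0) ^ (1 / 10 : ℝ)) ∂(dataLaw p ε θ) ≠ ⊤ := by
    rw [lintegral_tsum fun J => (hm J).aemeasurable]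
    have hsum : Summable fun J : ℕ => Real.exp (-(α / 10) * J) * Real.exp (B / 18) :=
      (summable_exp_neg_mul (by positivity)).mul_right _
    refine ne_top_of_le_ne_top hsum.tsum_ofReal_ne_top (ENNReal.tsum_le_tsum fun J => ?_)
    refine (lintegral_rpow_levelMass_div_le hε hK hα θ (Nat.zero_le J)).trans ?_
    rw [← Real.exp_add]
    refine ENNReal.ofReal_le_ofReal (Real.exp_le_exp.2 ?_)
    have := hle J
    rw [Nat.sub_zero]
    linarith
  filter_upwards [ae_lt_top' (AEMeasurable.tsum fun J => (hm J).aemeasurable) hfin] with X hX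
  have h0 := levelMass_pos (p := p) (ε := ε) (X := X) hK0 hα 0
  have hnn : ∀ J, 0 ≤ levelMass p K α ε X J / levelMass p K α ε X 0 := fun J =>
    div_nonneg (levelMass_pos hK0 hα J).le h0.le
  have h1 := ENNReal.summable_toReal hX.ne
  simp only [fun J => ENNReal.toReal_ofReal (Real.rpow_nonneg (hnn J) (1 / 10))] at h1
  have h2 := (summable_of_summable_rpow hnn (by norm_num) (by norm_num) h1).mul_right
    (levelMass p K α ε X 0)
  simpa [div_mul_cancel₀ _ h0.ne'] using h2

lemma levelDDM_map_eval (X : ℕ → ℝ) (I i : ℕ) :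
    MeasurePreserving (fun θ : ℕ → ℝ => θ i) (levelDDM p K ε X I) (gaussianReal (trunc X I i)
      (if i ≤ I then K / (K + 1) * noiseVar p ε i else 0).toNNReal) :=
  measurePreserving_eval_infinitePi _ i

lemma integrable_eval_levelDDM (X : ℕ → ℝ) (I i : ℕ) :
    Integrable (fun θ : ℕ → ℝ => θ i) (levelDDM p K ε X I) :=
  (levelDDM_map_eval X I i).integrable_comp_of_integrable
    (g := fun x => x) ((memLp_id_gaussianReal 1).integrable (by simp))

lemma integral_eval_levelDDM (X : ℕ → ℝ) (I i : ℕ) :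
    ∫ θ, θ i ∂(levelDDM p K ε X I) = trunc X I i := by
  have h := levelDDM_map_eval (p := p) (K := K) (ε := ε) X I i
  rw [← integral_id_gaussianReal (μ := trunc X I i)
    (v := (if i ≤ I then K / (K + 1) * noiseVar p ε i else 0).toNNReal), ← h.map_eq,
    integral_map h.measurable.aemeasurable (by fun_prop)]

lemma integral_norm_eval_levelDDM_le (X : ℕ → ℝ) (i : ℕ) :
    ∃ M, ∀ I, ∫ θ, ‖θ i‖ ∂(levelDDM p K ε X I) ≤ M := by
  have h : ∀ I, ∫ θ, ‖θ i‖ ∂(levelDDM p K ε X I) = ∫ x, ‖x‖ ∂(gaussianReal (trunc X I i)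
      (if i ≤ I then K / (K + 1) * noiseVar p ε i else 0).toNNReal) := by
    intro I
    have h := levelDDM_map_eval (p := p) (K := K) (ε := ε) X I i
    rw [← h.map_eq, integral_map h.measurable.aemeasurable (by fun_prop)]
  -- Only two marginals occur: the Gaussian one when `i ≤ I` and the Dirac measure at 0 otherwise.
  refine ⟨max (∫ x, ‖x‖ ∂(gaussianReal (X i) (K / (K + 1) * noiseVar p ε i).toNNReal)) 0,
    fun I => ?_⟩
  rw [h]
  by_cases hi : i ≤ I
  · simp only [trunc, hi, if_true]
    exact le_max_left _ _
  · simp [trunc, hi]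

lemma integrable_eval_ddm (hε : 0 < ε) (hK : 0 < K) (hα : 0 < α) {X : ℕ → ℝ}
    (hs : Summable (levelMass p K α ε X)) (i : ℕ) :
    Integrable (fun θ : ℕ → ℝ => θ i) (ddm p K α ε X) := by
  obtain ⟨M, hM⟩ := integral_norm_eval_levelDDM_le (p := p) (K := K) (ε := ε) X i
  refine integrable_sum_measure
    (fun I => (integrable_eval_levelDDM X I i).smul_measure ENNReal.ofReal_ne_top) ?_
  simp_rw [integral_smul_measure, levelPost_eq hε hK hα hs,
    ENNReal.toReal_ofReal (levelProb_nonneg hK hα _), smul_eq_mul]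
  refine Summable.of_nonneg_of_le (fun I => ?_) (fun I => ?_)
    ((hasSum_levelProb hK hα hs).summable.mul_right M)
  · exact mul_nonneg (levelProb_nonneg hK hα I) (integral_nonneg fun _ => norm_nonneg _)
  · exact mul_le_mul_of_nonneg_left (hM I) (levelProb_nonneg hK hα I)

lemma postMean_eq_integral (hε : 0 < ε) (hK : 0 < K) (hα : 0 < α) {X : ℕ → ℝ}
    (hs : Summable (levelMass p K α ε X)) (i : ℕ) :
    postMean p K α ε X i = ∫ θ, θ i ∂(ddm p K α ε X) := by
  have h := integrable_eval_ddm hε hK hα hs i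
  rw [ddm] at h ⊢
  rw [integral_sum_measure h, postMean]
  refine tsum_congr fun I => ?_
  rw [integral_smul_measure, levelPost_eq hε hK hα hs,
    ENNReal.toReal_ofReal (levelProb_nonneg hK hα _), integral_eval_levelDDM, smul_eq_mul, mul_comm]

/-- The posterior probability that the level is at least `i`. -/
noncomputable def fitProb (p K α ε : ℝ) (X : ℕ → ℝ) (i : ℕ) : ℝ :=
  ∑' I, levelProb p K α ε X (I + i)

/-! ### The estimator as a random shrinkage -/

section FitProb

variable {X : ℕ → ℝ}

lemma one_sub_fitProb (hK : 0 < K) (hα : 0 < α) (hs : Summable (levelMass p K α ε X)) (i : ℕ) :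
    1 - fitProb p K α ε X i = ∑ I ∈ Finset.range i, levelProb p K α ε X I := by
  have h := hasSum_levelProb hK hα hs
  rw [fitProb, ← h.tsum_eq, ← h.summable.sum_add_tsum_nat_add i]
  ring

lemma fitProb_nonneg (hK : 0 < K) (hα : 0 < α) (i : ℕ) : 0 ≤ fitProb p K α ε X i :=
  tsum_nonneg fun _ => levelProb_nonneg hK hα _

lemma fitProb_le_one (hK : 0 < K) (hα : 0 < α) (hs : Summable (levelMass p K α ε X)) (i : ℕ) :
    fitProb p K α ε X i ≤ 1 := by
  have h := one_sub_fitProb hK hα hs i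
  have := Finset.sum_nonneg fun I (_ : I ∈ Finset.range i) =>
    levelProb_nonneg (p := p) (ε := ε) (X := X) hK hα I
  linarith

lemma ofReal_fitProb (hK : 0 < K) (hα : 0 < α) (hs : Summable (levelMass p K α ε X)) (i : ℕ) :
    ENNReal.ofReal (fitProb p K α ε X i) =
      ∑' I, ENNReal.ofReal (levelProb p K α ε X (I + i)) :=
  ENNReal.ofReal_tsum_of_nonneg (fun _ => levelProb_nonneg hK hα _)
    ((summable_nat_add_iff i).2 (hasSum_levelProb hK hα hs).summable)

lemma postMean_eq_fitProb_mul (hε : 0 < ε) (hK : 0 < K) (hα : 0 < α)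
    (hs : Summable (levelMass p K α ε X)) (i : ℕ) :
    postMean p K α ε X i = fitProb p K α ε X i * X i := by
  have h := (hasSum_levelProb hK hα hs).summable
  rw [postMean, levelPost_eq hε hK hα hs, fitProb]
  have e : ∀ I, trunc X (I + i) i * levelProb p K α ε X (I + i) =
      levelProb p K α ε X (I + i) * X i := by
    intro I
    rw [trunc, if_pos (Nat.le_add_left i I), mul_comm]
  have hs' : Summable fun I => trunc X I i * levelProb p K α ε X I := by
    rw [← summable_nat_add_iff i]
    simp_rw [e]
    exact ((summable_nat_add_iff i).2 h).mul_right _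
  rw [← hs'.sum_add_tsum_nat_add i, Finset.sum_eq_zero, zero_add]
  · simp_rw [e, tsum_mul_right]
  · intro I hI
    rw [trunc, if_neg (by simpa using hI), zero_mul]

/-- Convexity of the square: `q x - t` is the mixture of `x - t` and `-t` with weights `q` and `1 -
q`. -/
lemma sq_postMean_sub_le (hε : 0 < ε) (hK : 0 < K) (hα : 0 < α)
    (hs : Summable (levelMass p K α ε X)) (i : ℕ) (t : ℝ) :
    (postMean p K α ε X i - t) ^ 2 ≤
      fitProb p K α ε X i * (X i - t) ^ 2 + (1 - fitProb p K α ε X i) * t ^ 2 := by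
  rw [postMean_eq_fitProb_mul hε hK hα hs]
  have h0 := fitProb_nonneg (p := p) (ε := ε) (X := X) hK hα i
  have h1 := fitProb_le_one hK hα hs i
  nlinarith [mul_nonneg (mul_nonneg h0 (sub_nonneg.2 h1)) (sq_nonneg (X i))]

end FitProb

lemma measurable_fitProb (i : ℕ) : Measurable fun X => fitProb p K α ε X i :=
  Measurable.tsum fun _ => measurable_levelProb _

end DDM

/-! ### Stochastic error and bias relative to reference levels -/

/-- Summation by parts in inductive form. With `w = 1 / σ²` it turns a bound on sums of `θ_i²` by
sums of `σ_i²` into a bound on sums of the ratios. -/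
lemma mul_sum_le_sum_mul_of_antitone {d w : ℕ → ℝ} (hw : Antitone w)
    (hd : ∀ n, 0 ≤ ∑ k ∈ Finset.range n, d k) (n : ℕ) :
    w n * ∑ k ∈ Finset.range n, d k ≤ ∑ k ∈ Finset.range n, d k * w k := by
  induction n with
  | zero => simp
  | succ n ih =>
    calc w (n + 1) * ∑ k ∈ Finset.range (n + 1), d k
        ≤ w n * ∑ k ∈ Finset.range (n + 1), d k :=
          mul_le_mul_of_nonneg_right (hw n.le_succ) (hd _)
      _ ≤ _ := by
          rw [Finset.sum_range_succ, Finset.sum_range_succ]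
          linarith

/-- A geometric sum of ratio `e ≥ 2` is dominated by its next term. -/
lemma sum_exp_sub_le (c : ℝ) (n : ℕ) :
    ∑ i ∈ Finset.range n, Real.exp (i - c) ≤ Real.exp (n - c) := by
  induction n with
  | zero => simpa using (Real.exp_pos _).le
  | succ n ih =>
    rw [Finset.sum_range_succ]
    have h1 : Real.exp ((n + 1 : ℕ) - c) = Real.exp 1 * Real.exp (n - c) := by
      rw [← Real.exp_add]; push_cast; ring_nf
    have h2 := Real.add_one_le_exp 1
    have h3 := Real.exp_pos (n - c)
    rw [h1]
    nlinarith

namespace DDM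

variable {p K α ε : ℝ} {θ : ℕ → ℝ}

/-- A probability is at most `min 1 R`, hence at most any power of `R` with exponent in `[0, 1]`. -/
lemma levelProb_le_rpow (hK : 0 < K) (hα : 0 < α) (X : ℕ → ℝ) (I J : ℕ) :
    levelProb p K α ε X I ≤ (levelMass p K α ε X I / levelMass p K α ε X J) ^ (1 / 10 : ℝ) := by
  have hR := div_pos (levelMass_pos (p := p) (ε := ε) (X := X) hK hα I)
    (levelMass_pos (p := p) (ε := ε) (X := X) hK hα J)
  rcases le_total (levelMass p K α ε X I / levelMass p K α ε X J) 1 with h | h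
  · refine (levelProb_le_ratio hK hα I J).trans ?_
    simpa using Real.rpow_le_rpow_of_exponent_ge hR h (by norm_num : (1 / 10 : ℝ) ≤ 1)
  · exact (levelProb_le_one hK hα I).trans (Real.one_le_rpow h (by norm_num))

lemma lintegral_fitProb_le (hε : 0 < ε) (hp : 0 ≤ p) (hK : 1.87 ≤ K) (hα : 0 < α)
    (hθ : Summable fun i => θ i ^ 2) {I₀ : ℕ}
    (h₀ : ∀ J, I₀ ≤ J → ∑ i ∈ Finset.Ico (I₀ + 1) (J + 1), θ i ^ 2 / noiseVar p ε i ≤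
      9 / 10 * α * ((J - I₀ : ℕ) : ℝ)) (m : ℕ) :
    ∫⁻ X, ENNReal.ofReal (fitProb p K α ε X (I₀ + m)) ∂(dataLaw p ε θ) ≤
      ENNReal.ofReal (Real.exp (-(α / 20) * m) * ∑' k : ℕ, Real.exp (-(α / 20) * k)) := by
  have hK0 : 0 < K := by linarith
  have hsum := summable_exp_neg_mul (c := α / 20) (by positivity)
  calc ∫⁻ X, ENNReal.ofReal (fitProb p K α ε X (I₀ + m)) ∂(dataLaw p ε θ)
      = ∫⁻ X, ∑' I, ENNReal.ofReal (levelProb p K α ε X (I + (I₀ + m))) ∂(dataLaw p ε θ) := by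
        refine lintegral_congr_ae ?_
        filter_upwards [ae_summable_levelMass hε hp hK hα hθ] with X hX
        exact ofReal_fitProb hK0 hα hX _
    _ = ∑' I, ∫⁻ X, ENNReal.ofReal (levelProb p K α ε X (I + (I₀ + m))) ∂(dataLaw p ε θ) :=
        lintegral_tsum fun I => (measurable_levelProb _).ennreal_ofReal.aemeasurable
    _ ≤ ∑' I : ℕ, ENNReal.ofReal (Real.exp (-(α / 20) * m) * Real.exp (-(α / 20) * I)) := by
        refine ENNReal.tsum_le_tsum fun I => ?_
        refine (lintegral_mono fun X => ENNReal.ofReal_le_ofReal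
          (levelProb_le_rpow hK0 hα X _ I₀)).trans ?_
        refine (lintegral_rpow_levelMass_div_le hε hK hα θ (by omega)).trans ?_
        refine ENNReal.ofReal_le_ofReal ?_
        rw [← Real.exp_add, Real.exp_le_exp]
        -- The exponent per level is `-α/10 + (9/10) α / 18 = -α/20`; this fixes the decay rate.
        have h := h₀ (I + (I₀ + m)) (by omega)
        rw [show I + (I₀ + m) - I₀ = I + m by omega] at h ⊢
        push_cast at h ⊢
        linarith
    _ = _ := by
        rw [← ENNReal.ofReal_tsum_of_nonneg (fun _ => by positivity) (hsum.mul_left _),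
          tsum_mul_left]

/-- `q_i` and `X_i` are dependent, so Young's inequality separates them: `q y ≤ δ y² / (2 v) + v q /
(2 δ)`, using `q² ≤ q`. Taking `δ` as the square root of the decay of the mean of `q_i` balances
both terms and halves the rate to `α/40`. -/
lemma lintegral_fitProb_mul_sq_le (hε : 0 < ε) (hp : 0 ≤ p) (hK : 1.87 ≤ K) (hα : 0 < α)
    (hθ : Summable fun i => θ i ^ 2) {I₀ : ℕ}
    (h₀ : ∀ J, I₀ ≤ J → ∑ i ∈ Finset.Ico (I₀ + 1) (J + 1), θ i ^ 2 / noiseVar p ε i ≤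
      9 / 10 * α * ((J - I₀ : ℕ) : ℝ)) (m : ℕ) :
    ∫⁻ X, ENNReal.ofReal (fitProb p K α ε X (I₀ + m) * (X (I₀ + m) - θ (I₀ + m)) ^ 2)
        ∂(dataLaw p ε θ) ≤
      ENNReal.ofReal (noiseVar p ε (I₀ + m) * (Real.exp (-(α / 40) * m) *
        (32 + (∑' k : ℕ, Real.exp (-(α / 20) * k)) / 2))) := by
  have hK0 : 0 < K := by linarith
  set i := I₀ + m
  set S := ∑' k : ℕ, Real.exp (-(α / 20) * k)
  have hS : 0 ≤ S := tsum_nonneg fun _ => (Real.exp_pos _).le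
  set δ := Real.exp (-(α / 40) * m)
  have hδ : 0 < δ := Real.exp_pos _
  have hv := noiseVar_pos (p := p) hε i
  have hδ2 : Real.exp (-(α / 20) * m) = δ * δ := by rw [← Real.exp_add]; ring_nf
  have hm4 : Measurable fun x : ℝ => ENNReal.ofReal ((x - θ i) ^ 4 / noiseVar p ε i) := by fun_prop
  have hm4' : Measurable fun X : ℕ → ℝ =>
      ENNReal.ofReal ((X i - θ i) ^ 4 / noiseVar p ε i) := hm4.comp (measurable_pi_apply i)
  calc ∫⁻ X, ENNReal.ofReal (fitProb p K α ε X i * (X i - θ i) ^ 2) ∂(dataLaw p ε θ)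
      ≤ ∫⁻ X, (ENNReal.ofReal (δ / 2) * ENNReal.ofReal ((X i - θ i) ^ 4 / noiseVar p ε i) +
          ENNReal.ofReal (noiseVar p ε i / (2 * δ)) * ENNReal.ofReal (fitProb p K α ε X i))
          ∂(dataLaw p ε θ) := by
        refine lintegral_mono_ae ?_
        filter_upwards [ae_summable_levelMass hε hp hK hα hθ] with X hX
        have h0 := fitProb_nonneg (p := p) (ε := ε) (X := X) hK0 hα i
        have h1 := fitProb_le_one hK0 hα hX i
        rw [← ENNReal.ofReal_mul (by positivity), ← ENNReal.ofReal_mul (by positivity),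
          ← ENNReal.ofReal_add (by positivity) (by positivity)]
        refine ENNReal.ofReal_le_ofReal ?_
        set q := fitProb p K α ε X i
        set y := (X i - θ i) ^ 2 with hy
        rw [show (X i - θ i) ^ 4 = y ^ 2 by rw [hy]; ring]
        have hq : q ^ 2 ≤ q := by nlinarith
        have e : δ / 2 * (y ^ 2 / noiseVar p ε i) + noiseVar p ε i / (2 * δ) * q - q * y =
            ((δ * y - noiseVar p ε i * q) ^ 2 + noiseVar p ε i ^ 2 * (q - q ^ 2)) /
              (2 * δ * noiseVar p ε i) := by
          field_simp; ring
        have : 0 ≤ ((δ * y - noiseVar p ε i * q) ^ 2 + noiseVar p ε i ^ 2 * (q - q ^ 2)) /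
              (2 * δ * noiseVar p ε i) :=
          div_nonneg (add_nonneg (sq_nonneg _) (mul_nonneg (sq_nonneg _) (by linarith)))
            (by positivity)
        linarith
    _ = ENNReal.ofReal (δ / 2) * ∫⁻ x, ENNReal.ofReal ((x - θ i) ^ 4 / noiseVar p ε i)
            ∂(gaussianReal (θ i) (noiseVar p ε i).toNNReal) +
          ENNReal.ofReal (noiseVar p ε i / (2 * δ)) *
            ∫⁻ X, ENNReal.ofReal (fitProb p K α ε X i) ∂(dataLaw p ε θ) := by
        rw [lintegral_add_left (hm4'.const_mul _), lintegral_const_mul _ hm4',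
          lintegral_const_mul _ (measurable_fitProb i).ennreal_ofReal, lintegral_eval_dataLaw θ i hm4]
    _ ≤ ENNReal.ofReal (δ / 2) * ENNReal.ofReal (64 * noiseVar p ε i) +
          ENNReal.ofReal (noiseVar p ε i / (2 * δ)) * ENNReal.ofReal (δ * δ * S) := by
        gcongr
        · exact lintegral_pow_four_sub_gaussianReal_le _ hv
        · rw [← hδ2]
          exact lintegral_fitProb_le hε hp hK hα hθ h₀ m
    _ = _ := by
        rw [← ENNReal.ofReal_mul (by positivity), ← ENNReal.ofReal_mul (by positivity),
          ← ENNReal.ofReal_add (by positivity) (by positivity)]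
        congr 1
        field_simp
        ring

lemma lintegral_fitProb_mul_sq_le_noiseVar (hε : 0 < ε) (hp : 0 ≤ p) (hK : 1.87 ≤ K) (hα : 0 < α)
    (hθ : Summable fun i => θ i ^ 2) (i : ℕ) :
    ∫⁻ X, ENNReal.ofReal (fitProb p K α ε X i * (X i - θ i) ^ 2) ∂(dataLaw p ε θ) ≤
      ENNReal.ofReal (8 * noiseVar p ε i) := by
  refine le_trans ?_ (lintegral_sq_sub_gaussianReal_le (θ i) (noiseVar_pos hε i))
  rw [← lintegral_eval_dataLaw θ i (f := fun x => ENNReal.ofReal ((x - θ i) ^ 2)) (by fun_prop)]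
  refine lintegral_mono_ae ?_
  filter_upwards [ae_summable_levelMass hε hp hK hα hθ] with X hX
  exact ENNReal.ofReal_le_ofReal
    (mul_le_of_le_one_left (sq_nonneg _) (fitProb_le_one (by linarith) hα hX i))

lemma noiseVar_add_le (hp : 0 ≤ p) (I m : ℕ) :
    noiseVar p ε (I + m) ≤ noiseVar p ε I * ((m : ℝ) + 1) ^ (2 * p) := by
  unfold noiseVar
  rw [mul_assoc, ← Real.mul_rpow (by positivity) (by positivity)]
  gcongr
  push_cast
  nlinarith [mul_nonneg (Nat.cast_nonneg (α := ℝ) I) (Nat.cast_nonneg (α := ℝ) m)]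

/-- The exponential decay of the fit probabilities beats the polynomial growth of the noise
variances. -/
lemma summable_rpow_mul_exp_neg {c : ℝ} (hc : 0 < c) (q : ℝ) :
    Summable fun m : ℕ => ((m : ℝ) + 1) ^ q * Real.exp (-c * m) := by
  obtain ⟨k, hk⟩ := exists_nat_ge q
  have h := ((summable_nat_add_iff 1).2 (Real.summable_pow_mul_exp_neg_nat_mul k hc)).mul_right
    (Real.exp c)
  refine Summable.of_nonneg_of_le (fun m => by positivity) (fun m => ?_) h
  rw [mul_assoc, ← Real.exp_add]
  push_cast
  rw [show -c * ((m : ℝ) + 1) + c = -c * m by ring]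
  gcongr
  rw [← Real.rpow_natCast]
  exact Real.rpow_le_rpow_of_exponent_le (by linarith [Nat.cast_nonneg (α := ℝ) m]) hk

/-- The constant bounding the stochastic error beyond the reference level. -/
noncomputable def tailConst (p α : ℝ) : ℝ :=
  (∑' m : ℕ, ((m : ℝ) + 1) ^ (2 * p) * Real.exp (-(α / 40) * m)) *
    (32 + (∑' k : ℕ, Real.exp (-(α / 20) * k)) / 2)

lemma tailConst_nonneg (p α : ℝ) : 0 ≤ tailConst p α :=
  mul_nonneg (tsum_nonneg fun _ => by positivity)
    (add_nonneg (by norm_num) (div_nonneg (tsum_nonneg fun _ => by positivity) (by norm_num)))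

lemma tsum_lintegral_fitProb_mul_sq_le (hε : 0 < ε) (hp : 0 ≤ p) (hK : 1.87 ≤ K) (hα : 0 < α)
    (hθ : Summable fun i => θ i ^ 2) {I₀ : ℕ}
    (h₀ : ∀ J, I₀ ≤ J → ∑ i ∈ Finset.Ico (I₀ + 1) (J + 1), θ i ^ 2 / noiseVar p ε i ≤
      9 / 10 * α * ((J - I₀ : ℕ) : ℝ)) :
    ∑' i, ∫⁻ X, ENNReal.ofReal (fitProb p K α ε X i * (X i - θ i) ^ 2) ∂(dataLaw p ε θ) ≤
      ENNReal.ofReal (8 * ∑ i ∈ Finset.range (I₀ + 1), noiseVar p ε i +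
        noiseVar p ε I₀ * tailConst p α) := by
  have hv := fun i => (noiseVar_pos (p := p) hε i).le
  set S := 32 + (∑' k : ℕ, Real.exp (-(α / 20) * k)) / 2 with hSdef
  have hS : 0 ≤ S := add_nonneg (by norm_num)
    (div_nonneg (tsum_nonneg fun _ => by positivity) (by norm_num))
  have hsum := (summable_rpow_mul_exp_neg (c := α / 40) (by positivity) (2 * p)).mul_right S
  -- The tail starts at `m = 0`, that is at `I₀` itself; the head is later enlarged to include `I₀`
  -- so that it matches the variance part of the rate.
  rw [← ENNReal.summable.sum_add_tsum_nat_add' (k := I₀),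
    ENNReal.ofReal_add (mul_nonneg (by norm_num) (Finset.sum_nonneg fun i _ => hv i))
      (mul_nonneg (hv _) (tailConst_nonneg _ _))]
  refine add_le_add ?_ ?_
  · rw [Finset.mul_sum, ENNReal.ofReal_sum_of_nonneg fun i _ => mul_nonneg (by norm_num) (hv i)]
    refine (Finset.sum_le_sum fun i _ =>
      lintegral_fitProb_mul_sq_le_noiseVar hε hp hK hα hθ i).trans ?_
    exact Finset.sum_le_sum_of_subset (Finset.range_subset_range.2 (Nat.le_succ _))
  · have e : noiseVar p ε I₀ * tailConst p α = ∑' m : ℕ, noiseVar p ε I₀ *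
        (((m : ℝ) + 1) ^ (2 * p) * Real.exp (-(α / 40) * m) * S) := by
      rw [tsum_mul_left, tsum_mul_right, tailConst]
    rw [e, ENNReal.ofReal_tsum_of_nonneg (fun m => mul_nonneg (hv _) (by positivity))
      (hsum.mul_left _)]
    refine ENNReal.tsum_le_tsum fun m => ?_
    rw [add_comm m I₀]
    refine (lintegral_fitProb_mul_sq_le hε hp hK hα hθ h₀ m).trans (ENNReal.ofReal_le_ofReal ?_)
    rw [mul_assoc, ← mul_assoc (noiseVar p ε I₀)]
    exact mul_le_mul_of_nonneg_right (noiseVar_add_le hp I₀ m) (by positivity)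

/-- Let `y` be the signal energy between `I` and `I₁` in units of `σ_{I₁}²`. The mean weight of `I`
is at most `exp ((α + K)(I₁ - I) - y/4)`. Half of `y/4` pays for `α + K + 1` per level; the other
half absorbs `θ_i² ≤ y σ_{I₁}²` through `u exp (-u) ≤ 1`. -/
lemma sq_mul_lintegral_levelProb_le (hε : 0 < ε) (hp : 0 ≤ p) (hK : 0 < K) (hα : 0 < α) {I₁ : ℕ}
    (h₁ : ∀ I, I ≤ I₁ → 8 * (α + K + 1) * ((I₁ - I : ℕ) : ℝ) * noiseVar p ε I₁ ≤
      ∑ i ∈ Finset.Ico (I + 1) (I₁ + 1), θ i ^ 2) {I i : ℕ} (hIi : I < i) (hi : i ≤ I₁) :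
    ENNReal.ofReal (θ i ^ 2) * ∫⁻ X, ENNReal.ofReal (levelProb p K α ε X I) ∂(dataLaw p ε θ) ≤
      ENNReal.ofReal (8 * noiseVar p ε I₁ * Real.exp (I - I₁)) := by
  have hv := noiseVar_pos (p := p) hε I₁
  set D := ∑ j ∈ Finset.Ico (I + 1) (I₁ + 1), θ j ^ 2 with hD
  have hDi : θ i ^ 2 ≤ D :=
    Finset.single_le_sum (f := fun j => θ j ^ 2) (fun _ _ => sq_nonneg _) (by simp; omega)
  have hDv : D / noiseVar p ε I₁ ≤
      ∑ j ∈ Finset.Ico (I + 1) (I₁ + 1), θ j ^ 2 / noiseVar p ε j := by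
    rw [hD, Finset.sum_div]
    refine Finset.sum_le_sum fun j hj => ?_
    exact div_le_div_of_nonneg_left (sq_nonneg _) (noiseVar_pos hε j)
      (noiseVar_mono hp (by simp at hj; omega))
  have hT : 8 * (α + K + 1) * ((I₁ - I : ℕ) : ℝ) ≤ D / noiseVar p ε I₁ := by
    rw [le_div_iff₀ hv]
    exact h₁ I (by omega)
  set y := D / noiseVar p ε I₁ with hy
  have hyD : D = noiseVar p ε I₁ * y := by rw [hy]; field_simp
  have hP : ∫⁻ X, ENNReal.ofReal (levelProb p K α ε X I) ∂(dataLaw p ε θ) ≤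
      ENNReal.ofReal (Real.exp (I - I₁) * Real.exp (-(y / 8))) := by
    refine (lintegral_mono fun X => ENNReal.ofReal_le_ofReal
      (levelProb_le_ratio hK hα I I₁)).trans ?_
    refine (lintegral_levelMass_div_le hε hK hα θ (by omega)).trans ?_
    refine ENNReal.ofReal_le_ofReal ?_
    rw [← Real.exp_add, Real.exp_le_exp]
    rw [Nat.cast_sub (by omega)] at hT ⊢
    linarith
  refine (mul_le_mul' (ENNReal.ofReal_le_ofReal hDi) hP).trans ?_
  rw [← ENNReal.ofReal_mul ((sq_nonneg _).trans hDi)]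
  refine ENNReal.ofReal_le_ofReal ?_
  have hye : y / 8 * Real.exp (-(y / 8)) ≤ 1 := by
    rw [Real.exp_neg, ← div_eq_mul_inv, div_le_one (Real.exp_pos _)]
    linarith [Real.add_one_le_exp (y / 8)]
  calc D * (Real.exp (I - I₁) * Real.exp (-(y / 8)))
      = 8 * noiseVar p ε I₁ * Real.exp (I - I₁) * (y / 8 * Real.exp (-(y / 8))) := by
        rw [hyD]; ring
    _ ≤ _ := mul_le_of_le_one_right (by positivity) hye

lemma tsum_lintegral_one_sub_fitProb_mul_sq_le (hε : 0 < ε) (hp : 0 ≤ p) (hK : 1.87 ≤ K)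
    (hα : 0 < α) (hθ : Summable fun i => θ i ^ 2) {I₁ : ℕ}
    (h₁ : ∀ I, I ≤ I₁ → 8 * (α + K + 1) * ((I₁ - I : ℕ) : ℝ) * noiseVar p ε I₁ ≤
      ∑ i ∈ Finset.Ico (I + 1) (I₁ + 1), θ i ^ 2) :
    ∑' i, ∫⁻ X, ENNReal.ofReal ((1 - fitProb p K α ε X i) * θ i ^ 2) ∂(dataLaw p ε θ) ≤
      ENNReal.ofReal (24 * noiseVar p ε I₁ + ∑' i, θ (i + (I₁ + 1)) ^ 2) := by
  have hK0 : 0 < K := by linarith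
  have hv := (noiseVar_pos (p := p) hε I₁).le
  rw [← ENNReal.summable.sum_add_tsum_nat_add' (k := I₁ + 1),
    ENNReal.ofReal_add (by positivity) (tsum_nonneg fun _ => sq_nonneg _)]
  refine add_le_add ?_ ?_
  · calc ∑ i ∈ Finset.range (I₁ + 1),
          ∫⁻ X, ENNReal.ofReal ((1 - fitProb p K α ε X i) * θ i ^ 2) ∂(dataLaw p ε θ)
        ≤ ∑ i ∈ Finset.range (I₁ + 1), ENNReal.ofReal (8 * noiseVar p ε I₁ * Real.exp (i - I₁)) := by
          refine Finset.sum_le_sum fun i hi => ?_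
          calc ∫⁻ X, ENNReal.ofReal ((1 - fitProb p K α ε X i) * θ i ^ 2) ∂(dataLaw p ε θ)
              = ∫⁻ X, ENNReal.ofReal (θ i ^ 2) * ∑ I ∈ Finset.range i,
                  ENNReal.ofReal (levelProb p K α ε X I) ∂(dataLaw p ε θ) := by
                refine lintegral_congr_ae ?_
                filter_upwards [ae_summable_levelMass hε hp hK hα hθ] with X hX
                rw [one_sub_fitProb hK0 hα hX, mul_comm, ENNReal.ofReal_mul (sq_nonneg _),
                  ENNReal.ofReal_sum_of_nonneg fun I _ => levelProb_nonneg hK0 hα I]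
            _ = ∑ I ∈ Finset.range i, ENNReal.ofReal (θ i ^ 2) *
                  ∫⁻ X, ENNReal.ofReal (levelProb p K α ε X I) ∂(dataLaw p ε θ) := by
                rw [lintegral_const_mul _ (Finset.measurable_sum _ fun I _ =>
                  (measurable_levelProb I).ennreal_ofReal), lintegral_finsetSum _ fun I _ =>
                  (measurable_levelProb I).ennreal_ofReal, Finset.mul_sum]
            _ ≤ ∑ I ∈ Finset.range i, ENNReal.ofReal (8 * noiseVar p ε I₁ * Real.exp (I - I₁)) :=
                Finset.sum_le_sum fun I hI => sq_mul_lintegral_levelProb_le hε hp hK0 hα h₁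
                  (by simpa using hI) (by simp at hi; omega)
            _ ≤ _ := by
                rw [← ENNReal.ofReal_sum_of_nonneg fun I _ => by positivity, ← Finset.mul_sum]
                exact ENNReal.ofReal_le_ofReal
                  (mul_le_mul_of_nonneg_left (sum_exp_sub_le _ _) (by positivity))
      _ ≤ _ := by
          rw [← ENNReal.ofReal_sum_of_nonneg fun I _ => by positivity, ← Finset.mul_sum]
          refine ENNReal.ofReal_le_ofReal ?_
          refine (mul_le_mul_of_nonneg_left (sum_exp_sub_le _ _) (by positivity)).trans ?_
          -- The two nested geometric sums leave one factor `e ≤ 3`, whence `24 = 8 * 3`.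
          have h3 : Real.exp (((I₁ + 1 : ℕ) : ℝ) - I₁) ≤ 3 := by
            push_cast
            rw [add_sub_cancel_left]
            linarith [Real.exp_one_lt_d9]
          nlinarith
  · rw [ENNReal.ofReal_tsum_of_nonneg (fun _ => sq_nonneg _) ((summable_nat_add_iff _).2 hθ)]
    refine ENNReal.tsum_le_tsum fun i => ?_
    refine (lintegral_mono (g := fun _ => ENNReal.ofReal (θ (i + (I₁ + 1)) ^ 2))
      fun X => ENNReal.ofReal_le_ofReal ?_).trans (by simp)
    have h0 := fitProb_nonneg (p := p) (ε := ε) (X := X) hK0 hα (i + (I₁ + 1))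
    exact mul_le_of_le_one_left (sq_nonneg _) (by linarith)

lemma risk_postMean_le (hε : 0 < ε) (hp : 0 ≤ p) (hK : 1.87 ≤ K)
    (hα : 0 < α) (hθ : Summable fun i => θ i ^ 2) :
    risk p ε (postMean p K α ε) θ ≤
      ∑' i, ∫⁻ X, ENNReal.ofReal (fitProb p K α ε X i * (X i - θ i) ^ 2) ∂(dataLaw p ε θ) +
      ∑' i, ∫⁻ X, ENNReal.ofReal ((1 - fitProb p K α ε X i) * θ i ^ 2) ∂(dataLaw p ε θ) := by
  have hK0 : 0 < K := by linarith
  have hm1 : ∀ i, Measurable fun X : ℕ → ℝ =>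
      ENNReal.ofReal (fitProb p K α ε X i * (X i - θ i) ^ 2) := fun i =>
    ((measurable_fitProb i).mul (by fun_prop)).ennreal_ofReal
  have hm2 : ∀ i, Measurable fun X : ℕ → ℝ =>
      ENNReal.ofReal ((1 - fitProb p K α ε X i) * θ i ^ 2) := fun i =>
    ((measurable_const.sub (measurable_fitProb i)).mul_const _).ennreal_ofReal
  rw [← ENNReal.tsum_add, risk]
  simp_rw [← fun i => lintegral_add_left (μ := dataLaw p ε θ) (hm1 i)
    (fun X => ENNReal.ofReal ((1 - fitProb p K α ε X i) * θ i ^ 2))]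
  rw [← lintegral_tsum (f := fun i X => ENNReal.ofReal (fitProb p K α ε X i * (X i - θ i) ^ 2) +
    ENNReal.ofReal ((1 - fitProb p K α ε X i) * θ i ^ 2))
    fun i => ((hm1 i).add (hm2 i)).aemeasurable]
  refine lintegral_mono_ae ?_
  filter_upwards [ae_summable_levelMass hε hp hK hα hθ] with X hX
  refine ENNReal.tsum_le_tsum fun i => ?_
  rw [← ENNReal.ofReal_add (mul_nonneg (fitProb_nonneg hK0 hα i) (sq_nonneg _))
    (mul_nonneg (sub_nonneg.2 (fitProb_le_one hK0 hα hX i)) (sq_nonneg _))]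
  exact ENNReal.ofReal_le_ofReal (sq_postMean_sub_le hε hK0 hα hX i (θ i))

end DDM

/-! ### Choice of the reference levels and comparison with the oracle rate -/

/-- The integral comparison `∫_0^n x^q ≤ ∑_{k=1}^n k^q`, proved increment by increment with
Bernoulli's inequality at `-1 / (n + 1)`. -/
lemma rpow_add_one_le_mul_sum {q : ℝ} (hq : 0 ≤ q) (n : ℕ) :
    (n : ℝ) ^ (q + 1) ≤ (q + 1) * ∑ k ∈ Finset.range n, ((k : ℝ) + 1) ^ q := by
  induction n with
  | zero => simp [Real.zero_rpow (by linarith : q + 1 ≠ 0)]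
  | succ n ih =>
    rw [Finset.sum_range_succ, mul_add]
    refine le_trans ?_ (add_le_add_left ih _)
    have hn : (0 : ℝ) < n + 1 := by positivity
    have h := one_add_mul_self_le_rpow_one_add (s := -1 / ((n : ℝ) + 1))
      (by rw [le_div_iff₀ hn]; linarith [Nat.cast_nonneg (α := ℝ) n])
      (by linarith : 1 ≤ q + 1)
    have e : 1 + -1 / ((n : ℝ) + 1) = n / (n + 1) := by field_simp; ring
    rw [e, Real.div_rpow (by positivity) hn.le, le_div_iff₀ (by positivity),
      Real.rpow_add_one hn.ne'] at h
    push_cast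
    rw [Real.rpow_add_one hn.ne']
    have e2 : (1 + (q + 1) * (-1 / ((n : ℝ) + 1))) * (((n : ℝ) + 1) ^ q * ((n : ℝ) + 1)) =
        ((n : ℝ) + 1) ^ q * ((n : ℝ) + 1) - (q + 1) * ((n : ℝ) + 1) ^ q := by
      field_simp
      ring
    linarith

namespace DDM

variable {p K α ε : ℝ} {θ : ℕ → ℝ}

lemma mul_noiseVar_le_sum (hp : 0 ≤ p) (I : ℕ) :
    ((I : ℝ) + 1) * noiseVar p ε I ≤
      (2 * p + 1) * ∑ i ∈ Finset.range (I + 1), noiseVar p ε i := by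
  have h := rpow_add_one_le_mul_sum (by positivity : 0 ≤ 2 * p) (I + 1)
  have hI : (0 : ℝ) < I + 1 := by positivity
  push_cast at h
  rw [Real.rpow_add_one hI.ne'] at h
  unfold noiseVar
  rw [← Finset.mul_sum]
  calc ((I : ℝ) + 1) * (ε ^ 2 * ((I : ℝ) + 1) ^ (2 * p))
      = ε ^ 2 * (((I : ℝ) + 1) ^ (2 * p) * ((I : ℝ) + 1)) := by ring
    _ ≤ ε ^ 2 * _ := mul_le_mul_of_nonneg_left h (sq_nonneg _)
    _ = _ := by ring

lemma noiseVar_le_sum (hε : 0 < ε) (I : ℕ) :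
    noiseVar p ε I ≤ ∑ i ∈ Finset.range (I + 1), noiseVar p ε i :=
  Finset.single_le_sum (f := noiseVar p ε) (fun i _ => (noiseVar_pos hε i).le) (by simp)

lemma tsum_tail_eq (hθ : Summable fun i => θ i ^ 2) {I J : ℕ} (hIJ : I ≤ J) :
    ∑' i, θ (i + (I + 1)) ^ 2 =
      ∑ i ∈ Finset.Ico (I + 1) (J + 1), θ i ^ 2 + ∑' i, θ (i + (J + 1)) ^ 2 := by
  have h1 := hθ.sum_add_tsum_nat_add (I + 1)
  have h2 := hθ.sum_add_tsum_nat_add (J + 1)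
  rw [← Finset.sum_range_add_sum_Ico _ (by omega : I + 1 ≤ J + 1)] at h2
  linarith

/-- A penalty of at least linear growth plus the squared bias attains its minimum over the
levels. -/
lemma exists_forall_add_tail_le {f : ℕ → ℝ} {c : ℝ} (hc : 0 < c)
    (hf : ∀ I : ℕ, c * I ≤ f I) (θ : ℕ → ℝ) :
    ∃ I₀ : ℕ, ∀ I : ℕ, f I₀ + ∑' i, θ (i + (I₀ + 1)) ^ 2 ≤ f I + ∑' i, θ (i + (I + 1)) ^ 2 := by
  have h : Tendsto (fun I => f I + ∑' i, θ (i + (I + 1)) ^ 2) cofinite atTop := by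
    rw [Nat.cofinite_eq_atTop]
    refine tendsto_atTop_mono (fun I => ?_)
      (tendsto_natCast_atTop_atTop.const_mul_atTop hc)
    exact (hf I).trans (le_add_of_nonneg_right (tsum_nonneg fun _ => sq_nonneg _))
  exact h.exists_forall_le

lemma sum_div_noiseVar_le (hε : 0 < ε) (hp : 0 ≤ p) {τ : ℝ} {I₀ : ℕ}
    (h : ∀ J, I₀ ≤ J → ∑ i ∈ Finset.Ico (I₀ + 1) (J + 1), θ i ^ 2 ≤
      τ * ∑ i ∈ Finset.Ico (I₀ + 1) (J + 1), noiseVar p ε i) {J : ℕ} (hJ : I₀ ≤ J) :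
    ∑ i ∈ Finset.Ico (I₀ + 1) (J + 1), θ i ^ 2 / noiseVar p ε i ≤ τ * ((J - I₀ : ℕ) : ℝ) := by
  have hv := noiseVar_pos (p := p) hε
  have hw : Antitone fun k => (noiseVar p ε (I₀ + 1 + k))⁻¹ := fun a b hab =>
    inv_anti₀ (hv _) (noiseVar_mono hp (by omega))
  have hd : ∀ n, 0 ≤ ∑ k ∈ Finset.range n,
      (τ * noiseVar p ε (I₀ + 1 + k) - θ (I₀ + 1 + k) ^ 2) := by
    intro n
    have := h (I₀ + n) (by omega)
    rw [Finset.sum_Ico_eq_sum_range, Finset.sum_Ico_eq_sum_range,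
      show I₀ + n + 1 - (I₀ + 1) = n by omega] at this
    rw [Finset.sum_sub_distrib, ← Finset.mul_sum]
    linarith
  have key := mul_sum_le_sum_mul_of_antitone hw hd (J - I₀)
  have h0 := (mul_nonneg (inv_pos.2 (hv (I₀ + 1 + (J - I₀)))).le (hd (J - I₀))).trans key
  have e : ∀ k, (τ * noiseVar p ε (I₀ + 1 + k) - θ (I₀ + 1 + k) ^ 2) *
      (noiseVar p ε (I₀ + 1 + k))⁻¹ =
      τ - θ (I₀ + 1 + k) ^ 2 / noiseVar p ε (I₀ + 1 + k) := by
    intro k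
    have := (hv (I₀ + 1 + k)).ne'
    field_simp
  simp_rw [e] at h0
  rw [Finset.sum_sub_distrib, Finset.sum_const, Finset.card_range, nsmul_eq_mul] at h0
  rw [Finset.sum_Ico_eq_sum_range, show J + 1 - (I₀ + 1) = J - I₀ by omega]
  linarith

/-- The constant of the oracle inequality. -/
noncomputable def oracleConst (p K α : ℝ) : ℝ :=
  1 + (8 + tailConst p α) * ((9 / 10 * α + 1) / (9 / 10 * α)) +
    (24 / (8 * (α + K + 1)) + 1) * (8 * (α + K + 1) * (2 * p + 1) + 1)

lemma one_le_oracleConst (hp : 0 ≤ p) (hK : 0 < K) (hα : 0 < α) : 1 ≤ oracleConst p K α := by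
  have := tailConst_nonneg p α
  have h1 : 0 ≤ (8 + tailConst p α) * ((9 / 10 * α + 1) / (9 / 10 * α)) := by positivity
  have h2 : 0 ≤ (24 / (8 * (α + K + 1)) + 1) * (8 * (α + K + 1) * (2 * p + 1) + 1) := by
    positivity
  unfold oracleConst
  linarith

lemma risk_postMean_le_rateSq (hε : 0 < ε) (hp : 0 ≤ p) (hK : 1.87 ≤ K)
    (hα : 0 < α) (hθ : Summable fun i => θ i ^ 2) (I : ℕ) :
    risk p ε (postMean p K α ε) θ ≤ ENNReal.ofReal (oracleConst p K α * rateSq p ε θ I) := by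
  have hK0 : 0 < K := by linarith
  have hv := noiseVar_pos (p := p) hε
  have hlin : ∀ I : ℕ, ((I : ℝ) + 1) * noiseVar p ε 0 ≤
      ∑ i ∈ Finset.range (I + 1), noiseVar p ε i := by
    intro I
    have := Finset.card_nsmul_le_sum (Finset.range (I + 1)) (noiseVar p ε) (noiseVar p ε 0)
      fun i _ => noiseVar_mono hp (Nat.zero_le i)
    simpa using this
  set τ := 9 / 10 * α with hτdef
  have hτ : 0 < τ := by positivity
  set T := 8 * (α + K + 1) with hTdef
  have hT : 0 < T := by positivity
  -- The factor `9/10 * α` of the first penalty is small enough for the prior decay to dominate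
  -- beyond `I₀`. The second penalty uses `(I + 1) σ_I²` rather than the sum of variances because
  -- levels below `I₁` need a gap of `T (I₁ - I)` in units of the largest variance `σ_{I₁}²`.
  obtain ⟨I₀, hI₀⟩ := exists_forall_add_tail_le
    (f := fun I => τ * ∑ i ∈ Finset.range (I + 1), noiseVar p ε i)
    (mul_pos hτ (hv 0)) (fun I => by nlinarith [hlin I, mul_pos hτ (hv 0)]) θ
  obtain ⟨I₁, hI₁⟩ := exists_forall_add_tail_le
    (f := fun I => T * (((I : ℝ) + 1) * noiseVar p ε I))
    (mul_pos hT (hv 0)) (fun I => by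
      rw [mul_assoc]
      refine mul_le_mul_of_nonneg_left ?_ hT.le
      rw [mul_comm]
      exact mul_le_mul (by linarith) (noiseVar_mono hp (Nat.zero_le I)) (hv 0).le
        (by positivity)) θ
  have h₀ : ∀ J, I₀ ≤ J → ∑ i ∈ Finset.Ico (I₀ + 1) (J + 1), θ i ^ 2 ≤
      τ * ∑ i ∈ Finset.Ico (I₀ + 1) (J + 1), noiseVar p ε i := by
    intro J hJ
    have h := hI₀ J
    have h2 := tsum_tail_eq hθ hJ
    simp only [← Finset.sum_range_add_sum_Ico (noiseVar p ε) (by omega : I₀ + 1 ≤ J + 1)] at h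
    linarith
  have h₁ : ∀ I, I ≤ I₁ → T * ((I₁ - I : ℕ) : ℝ) * noiseVar p ε I₁ ≤
      ∑ i ∈ Finset.Ico (I + 1) (I₁ + 1), θ i ^ 2 := by
    intro I hI
    have h := hI₁ I
    have h2 := tsum_tail_eq hθ hI
    have h3 : T * (((I : ℝ) + 1) * noiseVar p ε I) ≤ T * (((I : ℝ) + 1) * noiseVar p ε I₁) := by
      gcongr
      exact noiseVar_mono hp hI
    rw [Nat.cast_sub hI]
    linarith
  refine (risk_postMean_le hε hp hK hα hθ).trans ((add_le_add
    (tsum_lintegral_fitProb_mul_sq_le hε hp hK hα hθ fun J hJ => sum_div_noiseVar_le hε hp h₀ hJ)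
    (tsum_lintegral_one_sub_fitProb_mul_sq_le hε hp hK hα hθ h₁)).trans ?_)
  have hD := tailConst_nonneg p α
  have hsum : ∀ I, 0 ≤ ∑ i ∈ Finset.range (I + 1), noiseVar p ε i := fun I =>
    Finset.sum_nonneg fun i _ => (hv i).le
  have htail : ∀ I, 0 ≤ ∑' i, θ (i + (I + 1)) ^ 2 := fun I => tsum_nonneg fun _ => sq_nonneg _
  have hv₁ := hv I₁
  rw [← ENNReal.ofReal_add (add_nonneg (mul_nonneg (by norm_num) (hsum _))
    (mul_nonneg (hv _).le hD)) (add_nonneg (by positivity) (htail _))]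
  refine ENNReal.ofReal_le_ofReal ?_
  set r := rateSq p ε θ I with hr
  have hr0 : 0 ≤ r := add_nonneg (hsum I) (htail I)
  have hb₀ : ∑ i ∈ Finset.range (I₀ + 1), noiseVar p ε i ≤ (τ + 1) / τ * r := by
    rw [div_mul_eq_mul_div, le_div_iff₀ hτ]
    have h := hI₀ I
    have e : r = ∑ i ∈ Finset.range (I + 1), noiseVar p ε i + ∑' i, θ (i + (I + 1)) ^ 2 := rfl
    nlinarith [htail I₀, hsum I, htail I, mul_nonneg hτ.le (htail I)]
  have hb₁ : T * noiseVar p ε I₁ + ∑' i, θ (i + (I₁ + 1)) ^ 2 ≤ (T * (2 * p + 1) + 1) * r := by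
    have h := hI₁ I
    have e : r = ∑ i ∈ Finset.range (I + 1), noiseVar p ε i + ∑' i, θ (i + (I + 1)) ^ 2 := rfl
    have h2 := mul_le_mul_of_nonneg_left (mul_noiseVar_le_sum (ε := ε) hp I) hT.le
    have h3 : T * noiseVar p ε I₁ ≤ T * (((I₁ : ℝ) + 1) * noiseVar p ε I₁) :=
      mul_le_mul_of_nonneg_left (le_mul_of_one_le_left hv₁.le
        (by linarith [Nat.cast_nonneg (α := ℝ) I₁])) hT.le
    have h4 : 0 ≤ T * (2 * p + 1) * ∑' i, θ (i + (I + 1)) ^ 2 :=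
      mul_nonneg (by positivity) (htail I)
    rw [e]
    linarith [hsum I]
  have hc₀ : noiseVar p ε I₀ * tailConst p α ≤ (τ + 1) / τ * r * tailConst p α :=
    mul_le_mul_of_nonneg_right ((noiseVar_le_sum hε I₀).trans hb₀) hD
  have hc₁ : 24 * noiseVar p ε I₁ ≤ 24 / T * ((T * (2 * p + 1) + 1) * r) := by
    rw [div_mul_eq_mul_div, le_div_iff₀ hT]
    linarith [htail I₁]
  have hc₂ : ∑' i, θ (i + (I₁ + 1)) ^ 2 ≤ (T * (2 * p + 1) + 1) * r := by
    linarith [mul_pos hT hv₁]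
  -- The lone summand `r` stems from the `1` in `oracleConst`, which serves only to make the
  -- constant at least 1.
  have e : oracleConst p K α * r = r + 8 * ((τ + 1) / τ * r) + (τ + 1) / τ * r * tailConst p α +
      24 / T * ((T * (2 * p + 1) + 1) * r) + (T * (2 * p + 1) + 1) * r := by
    unfold oracleConst
    ring
  rw [e]
  linarith

end DDM

/-! ### The oracle inequality -/

theorem theorem3p2 (p K α : ℝ) (hp : 0 ≤ p) (hK : 1.87 ≤ K) (hα : 0 < α) :
    ∃ C : ℝ, 1 ≤ C ∧ ∀ ε : ℝ, 0 < ε → ∀ θ₀ : lp (fun _ : ℕ => ℝ) 2,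
      -- almost surely, the weights are limits and sum to one, and the estimator is the
      -- expectation of the data dependent measure
      (∀ᵐ X ∂(DDM.dataLaw p ε θ₀),
        (∀ I, Tendsto (fun n => DDM.levelPostN p K α ε n X I) atTop
          (𝓝 (DDM.levelPost p K α ε X I))) ∧
        HasSum (DDM.levelPost p K α ε X) 1 ∧
        ∀ i, Integrable (fun θ : ℕ → ℝ => θ i) (DDM.ddm p K α ε X) ∧
          DDM.postMean p K α ε X i = ∫ θ, θ i ∂(DDM.ddm p K α ε X)) ∧
      Measurable (DDM.postMean p K α ε) ∧
      -- the oracle inequality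
      DDM.risk p ε (DDM.postMean p K α ε) θ₀ ≤
        ENNReal.ofReal (C * DDM.oracleRateSq p ε θ₀) := by
  have hK0 : 0 < K := by linarith
  have hC := DDM.one_le_oracleConst hp hK0 hα
  refine ⟨DDM.oracleConst p K α, hC, fun ε hε θ₀ => ?_⟩
  have hθ : Summable fun i => θ₀ i ^ 2 := by
    simpa using (lp.memℓp θ₀).summable (by norm_num)
  refine ⟨?_, DDM.measurable_postMean, ?_⟩
  · filter_upwards [DDM.ae_summable_levelMass hε hp hK hα hθ] with X hX
    have e := DDM.levelPost_eq hε hK0 hα hX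
    refine ⟨fun I => ?_, ?_, fun i =>
      ⟨DDM.integrable_eval_ddm hε hK0 hα hX i, DDM.postMean_eq_integral hε hK0 hα hX i⟩⟩
    · rw [e]
      exact DDM.tendsto_levelPostN hε hK0 hα hX I
    · rw [e]
      exact DDM.hasSum_levelProb hK0 hα hX
  · have h := DDM.risk_postMean_le_rateSq hε hp hK hα hθ
    rw [DDM.oracleRateSq, Real.mul_iInf_of_nonneg (by linarith)]
    -- The bound at a single level makes the risk finite, so the infimum over levels can be taken
    -- among real numbers.
    have hfin : DDM.risk p ε (DDM.postMean p K α ε) θ₀ ≠ ⊤ :=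
      ne_top_of_le_ne_top ENNReal.ofReal_ne_top (h 0)
    rw [← ENNReal.ofReal_toReal hfin]
    refine ENNReal.ofReal_le_ofReal (le_ciInf fun I => ?_)
    refine ENNReal.toReal_le_of_le_ofReal (mul_nonneg (by linarith) ?_) (h I)
    exact add_nonneg (Finset.sum_nonneg fun i _ => (DDM.noiseVar_pos hε i).le)
      (tsum_nonneg fun _ => sq_nonneg _)
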